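/- Let $\rho\in\{1,2\}$, let $K\ge 0$ be the number of hidden layers, $n_0,\dots,n_{K+1}$ the layer widths, and let $x_1,\dots,x_D\in\mathbb{R}^{n_0}$ be input points with stacked vector $X\in\mathbb{R}^{Dn_0}$. For $w=(W,b)\in\mathbb{R}^{m\times n}\times\mathbb{R}^m$ put $L_w(z)=(Wz_d+b)_{d\le D}$ for stacked vectors $z=(z_d)_{d\le D}\in\mathbb{R}^{Dn}$. Let $\sigma_k:\mathbb{R}^{n_k}\to\mathbb{R}^{n_k}$ be $L$-Lipschitz activations, applied to each of the $D$ blocks of a stacked vector. Consider the stochastic neural network $z_1=L_{w_0}(X)$, $z_{k+1}=L_{w_k}(\sigma_k(z_k))$ for $1\le k\le K$, with independent random parameters $w_k=(W_k,b_k)\sim p_{w_k}$ such that for each fixed $z$ the law $p_{L_{w_k}(z)}$ of $L_{w_k}(z)$ is a (possibly degenerate) Gaussian (for instance, $p_{w_k}$ Gaussian). Let $p_{nn(X)}$ be the law of $z_{K+1}$. Approximation without compression. Put $q_1=p_{L_{w_0}(X)}$. Given a Gaussian mixture $q_k=\sum_i\pi_i\mu_i$, choose for each component $\mu_i$ a finite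 set of locations $\{c_{ij}\}_j\subset\mathbb{R}^{Dn_k}$, with Voronoi partition $\{R_{ij}\}_j$ ($R_{ij}$ consists of the points whose nearest location is $c_{ij}$, ties broken by smallest index), and put $q_{k+1}=\sum_{i,j}\pi_i\,\mu_i(R_{ij})\,p_{L_{w_k}(\sigma_k(c_{ij}))}$. The locations are grid-structured if, for each $i$, there are an orthonormal basis $(v_l)$ of eigenvectors of the covariance of $\mu_i$, with eigenvalues $\lambda_l$, and nonempty finite sets $G_l\subset\mathbb{R}$ with $\{c_{ij}\}_j=\{m_i+\sum_l\sqrt{\lambda_l}\,t_l v_l : t_l\in G_l\}$, $m_i$ being the mean of $\mu_i$. Wasserstein bound. Let $\hat S_k\in[0,\infty)$ satisfy $D^{1/2}\,\mathbb{E}[\|W_k\|^\rho]^{1/\rho}\le\hat S_k$ (spectral norm), and for each layer $k$ and each set $R$ let $\ell_k(R)\le L$ be a Lipschitz constant on $R$ of the stacked activation (for instance $\ell_k(R)=L$). Put $\hat W_1=0$ and, for $1\le k\le K$, $$\hat W_{k+1}=\hat S_k\bigl(L\,\hat W_k+\hat W_{\Delta,k}\bigr),\qquad \hat W_{\Delta,k}=\Bigl(\sum_{i}\pi_i\sum_j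 \ell_k(R_{ij})^\rho\int_{R_{ij}}\|z-c_{ij}\|^\rho\,d\mu_i(z)\Bigr)^{1/\rho}.$$ Then for every $\epsilon>0$ there are finite grid-structured signature locations at every layer $k=1,\dots,K$ such that all $q_k$ are Gaussian mixtures and $$\mathbb{W}_\rho\bigl(p_{nn(X)},q_{K+1}\bigr)\;\le\;\hat W_{K+1}\;<\;\epsilon .$$ -/

import Mathlib

open MeasureTheory ProbabilityTheory
open scoped NNReal ENNReal

noncomputable section

namespace SNN

/-! ### Wasserstein distance -/

/-- The couplings of two measures: measures on the product with the two given marginals. -/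
def couplings {F : Type*} [MeasurableSpace F] (μ ν : Measure F) : Set (Measure (F × F)) :=
  {γ | γ.map Prod.fst = μ ∧ γ.map Prod.snd = ν}

/-- The `ρ`-Wasserstein distance `(inf_γ E_{(x,y) ∼ γ} ‖x - y‖^ρ)^(1/ρ)`, with values in `[0, ∞]`. -/
def wasserstein {F : Type*} [NormedAddCommGroup F] [MeasurableSpace F]
    (ρ : ℕ) (μ ν : Measure F) : ℝ≥0∞ :=
  (⨅ γ ∈ couplings μ ν, ∫⁻ z, ‖z.1 - z.2‖ₑ ^ ρ ∂γ) ^ (1 / (ρ : ℝ))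

/-! ### Fully connected networks evaluated at `D` inputs simultaneously -/

/-- `ℝⁿ` with its Euclidean norm. -/
abbrev Vec (n : ℕ) : Type := EuclideanSpace ℝ (Fin n)

/-- `D`-tuples of vectors of `ℝⁿ`, with the Euclidean norm of `ℝ^{D n}`. -/
abbrev Stack (D n : ℕ) : Type := PiLp 2 (fun _ : Fin D => Vec n)

/-- Parameters `w = (W, b)` of an affine layer from `ℝⁿ` to `ℝᵐ`. The matrix `W` is identified with
the linear map it represents, so that `‖W‖` is the spectral norm. -/
abbrev Params (n m : ℕ) : Type := (Vec n →L[ℝ] Vec m) × Vec m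

/-- The stacked affine layer: `z ↦ (W z_d + b)_{d ≤ D}`. -/
def affine {D n m : ℕ} (w : Params n m) (z : Stack D n) : Stack D m :=
  WithLp.toLp 2 fun d => w.1 (z d) + w.2

/-- The stacked activation: `z ↦ (σ z_d)_{d ≤ D}`. -/
def act {D n : ℕ} (σ : Vec n → Vec n) (z : Stack D n) : Stack D n :=
  WithLp.toLp 2 fun d => σ (z d)

/-- The layers of the network with weights `w` at the stacked input `X`:
`z_0 = X`, `z_1 = L_{w_0}(X)` and `z_{k+1} = L_{w_k}(σ_k(z_k))` for `k ≥ 1`. -/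
def layer {D : ℕ} {n : ℕ → ℕ} (σ : ∀ k, Vec (n k) → Vec (n k))
    (w : ∀ k, Params (n k) (n (k + 1))) (X : Stack D (n 0)) : ∀ k, Stack D (n k)
  | 0 => X
  | 1 => affine (w 0) X
  | k + 2 => affine (w (k + 1)) (act (σ (k + 1)) (layer σ w X (k + 1)))

/-- The joint law of the output `z_{K+1}` of the network with `K` hidden layers at the `D` inputs,
when the parameters `w_0, w_1, …` of the layers are independent with laws `p 0, p 1, …`. -/
def outputLaw {D : ℕ} {n : ℕ → ℕ} (σ : ∀ k, Vec (n k) → Vec (n k))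
    (p : ∀ k, Measure (Params (n k) (n (k + 1)))) (X : Stack D (n 0)) (K : ℕ) :
    Measure (Stack D (n (K + 1))) :=
  (Measure.infinitePi p).map fun w => layer σ w X (K + 1)

/-- The law `p_{L_w(z)}` of the stacked affine layer at a fixed `z`, for `w ∼ p`. -/
def affineLaw {D n m : ℕ} (p : Measure (Params n m)) (z : Stack D n) : Measure (Stack D m) :=
  p.map fun w => affine w z

/-! ### Mixtures and signatures -/

/-- The data of a finite mixture of measures. -/
structure Mixture (F : Type) [MeasurableSpace F] where
  /-- the index set of the components -/
  ι : Type
  fintype : Fintype ι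
  /-- the weights -/
  weight : ι → ℝ≥0∞
  /-- the components -/
  comp : ι → Measure F

attribute [instance] Mixture.fintype

/-- The measure `∑ᵢ πᵢ μᵢ`. -/
def Mixture.law {F : Type} [MeasurableSpace F] (q : Mixture F) : Measure F :=
  ∑ i, q.weight i • q.comp i

/-- The mixture is a Gaussian mixture: the weights sum to one and the components are (possibly
degenerate) Gaussian measures. -/
structure Mixture.IsGMM {F : Type} [NormedAddCommGroup F] [InnerProductSpace ℝ F]
    [MeasurableSpace F] (q : Mixture F) : Prop where
  weight_sum : ∑ i, q.weight i = 1
  gaussian : ∀ i, IsGaussian (q.comp i)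

/-- A finite family of pairwise distinct signature locations. -/
structure Locations (F : Type) where
  /-- the number of locations -/
  N : ℕ
  /-- the locations -/
  pt : Fin N → F
  inj : Function.Injective pt

/-- The Voronoi region `R_j` of the `j`-th location: the points whose nearest location is the
`j`-th one, ties being resolved in favour of the smallest index, so that the regions form a
partition. -/
def Locations.region {F : Type} [NormedAddCommGroup F] (C : Locations F) (j : Fin C.N) : Set F :=
  {z | (∀ l, ‖z - C.pt j‖ ≤ ‖z - C.pt l‖) ∧ ∀ l < j, ‖z - C.pt j‖ < ‖z - C.pt l‖}

/-- The locations form a grid adapted to `μ`: there are an orthonormal basis `v` of eigenvectors of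
the covariance of `μ`, with eigenvalues `lam`, and nonempty finite sets `G l ⊆ ℝ` such that the set
of locations is `{m + ∑ₗ √(lam l) tₗ vₗ : tₗ ∈ G l}`, with `m` the mean of `μ`. In other words, it
is the grid `∏ₗ G l` in the coordinates in which `μ` is standardised. -/
def Locations.IsGrid {F : Type} [NormedAddCommGroup F] [InnerProductSpace ℝ F]
    [FiniteDimensional ℝ F] [MeasurableSpace F] [BorelSpace F]
    (C : Locations F) (μ : Measure F) : Prop :=
  ∃ (v : OrthonormalBasis (Fin (Module.finrank ℝ F)) ℝ F)
    (lam : Fin (Module.finrank ℝ F) → ℝ) (G : Fin (Module.finrank ℝ F) → Finset ℝ),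
    (∀ l y, covarianceBilin μ (v l) y = lam l * inner ℝ (v l) y) ∧
    (∀ l, (G l).Nonempty) ∧
    Set.range C.pt = {x | ∃ t : Fin (Module.finrank ℝ F) → ℝ,
      (∀ l, t l ∈ G l) ∧ x = (∫ y, y ∂μ) + ∑ l, (Real.sqrt (lam l) * t l) • v l}

/-! ### The Gaussian mixture approximation, without compression, and its error bound -/

/-- The approximation of the first layer: one component, `p_{L_{w_0}(X)}`. -/
def firstMixture {D n m : ℕ} (p : Measure (Params n m)) (X : Stack D n) :
    Mixture (Stack D m) where
  ι := Unit
  fintype := inferInstance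
  weight := fun _ => 1
  comp := fun _ => affineLaw p X

/-- One step of the approximation: the `i`-th component `μᵢ` of `q = ∑ᵢ πᵢ μᵢ` is replaced by its
signature `∑ⱼ μᵢ(Rᵢⱼ) δ_{cᵢⱼ}`, which is then propagated through the activation and the next
stochastic affine layer. This gives `∑ᵢⱼ πᵢ μᵢ(Rᵢⱼ) p_{L_w(σ(cᵢⱼ))}`. -/
def nextMixture {D n m : ℕ} (σ : Vec n → Vec n) (p : Measure (Params n m))
    (q : Mixture (Stack D n)) (C : q.ι → Locations (Stack D n)) : Mixture (Stack D m) where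
  ι := Σ i, Fin (C i).N
  fintype := inferInstance
  weight := fun ij => q.weight ij.1 * q.comp ij.1 ((C ij.1).region ij.2)
  comp := fun ij => affineLaw p (act σ ((C ij.1).pt ij.2))

/-- The bound on the error of the signature step,
`(∑ᵢ πᵢ ∑ⱼ ℓ(Rᵢⱼ)^ρ μᵢ(Rᵢⱼ) E_{z ∼ μᵢ}[‖z - cᵢⱼ‖^ρ | z ∈ Rᵢⱼ])^(1/ρ)`,
where `ℓ(R)` is a Lipschitz constant of the activation on the region `R`. -/
def signatureBound {F : Type} [NormedAddCommGroup F] [MeasurableSpace F] (ρ : ℕ)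
    (ℓ : Set F → ℝ≥0) (q : Mixture F) (C : q.ι → Locations F) : ℝ≥0∞ :=
  (∑ i, q.weight i * ∑ j : Fin (C i).N, (ℓ ((C i).region j) : ℝ≥0∞) ^ ρ *
    ∫⁻ z in (C i).region j, ‖z - (C i).pt j‖ₑ ^ ρ ∂(q.comp i)) ^ (1 / (ρ : ℝ))

/-- The bound `Ŵ_k` on the error at layer `k`: `Ŵ_1 = 0` and
`Ŵ_{k+1} = S_k (L Ŵ_k + Δ_k)` for `k ≥ 1`, where `Δ_k` is the bound on the error of the `k`-th
signature step. -/
def errorBound (S : ℕ → ℝ≥0) (L : ℝ≥0) (Δ : ℕ → ℝ≥0∞) : ℕ → ℝ≥0∞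
  | 0 => 0
  | 1 => 0
  | k + 2 => S (k + 1) * (L * errorBound S L Δ (k + 1) + Δ (k + 1))

end SNN

end

/-!
The law of a layer is compared with its approximating mixture through a coupling that remembers the
components of the mixture (`IsCoupling`): for every component `i` there is a measure `γ i` on pairs
`(z, y)` whose second marginal is `πᵢ μᵢ`, and the first marginals add up to the law of the layer.
Such a coupling can be pushed through a layer without any gluing. Restrict `γ i` to the pairs with
`y` in the Voronoi region `Rᵢⱼ`, replace `y` by the location `cᵢⱼ`, and propagate `z` and `cᵢⱼ`
through the activation and the affine layer with the same random parameters. Since the parameters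
are independent of the input of their layer (`outputLaw_succ`), this is a coupling of the next layer
with the next mixture (`IsCoupling.next`). On `Rᵢⱼ` the two images under the activation are at
distance at most `L ‖z - y‖ + ℓ(Rᵢⱼ) ‖y - cᵢⱼ‖`, and the random affine layer multiplies distances by
at most `S` in the `ρ`-th mean, so Minkowski's inequality gives exactly the recursion of the error
bound (`IsCoupling.cost_next_le`). By induction the Wasserstein distance is at most the error bound.

The error bound is at most a finite constant, depending only on `S`, `L` and the number of layers,
times the largest error of a signature step (`errorBound_le_mul`). It therefore suffices that every
Gaussian measure admits grids of arbitrarily small cost (`IsGaussian.exists_isGrid_lt`). In an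
eigenbasis of the covariance, take grids of mesh `1/N` on `[-N, N]` in the standardised coordinates.
The distance from a point to these grids tends to `0` as soon as its deviation from the mean has no
component along the eigenvectors with eigenvalue `0`, which holds almost surely because a random
variable of variance `0` is almost surely constant. As the mean is a point of every grid, the
distance is dominated by the distance to the mean, whose moments are finite by Fernique's theorem,
and dominated convergence applies.
-/

noncomputable section

namespace SNN

/-! ### Voronoi regions -/

section Voronoi

lemma exists_locations_range_eq {F : Type} (s : Finset F) :
    ∃ C : Locations F, Set.range C.pt = s := by
  refine ⟨⟨s.card, fun j => (s.equivFin.symm j : F),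
    Subtype.val_injective.comp s.equivFin.symm.injective⟩, ?_⟩
  change Set.range (Subtype.val ∘ s.equivFin.symm) = s
  rw [s.equivFin.symm.surjective.range_comp]
  simp

variable {F : Type} [NormedAddCommGroup F]

lemma Locations.pt_mem_region (C : Locations F) (j : Fin C.N) : C.pt j ∈ C.region j := by
  refine ⟨fun l => by simp, fun l hl => ?_⟩
  rw [sub_self, norm_zero, norm_pos_iff, sub_ne_zero]
  exact fun h => hl.ne' (C.inj h)

lemma Locations.pairwise_disjoint_region (C : Locations F) :
    Pairwise (Function.onFun Disjoint C.region) := by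
  intro i j hij
  refine Set.disjoint_left.2 fun z hi hj => ?_
  rcases lt_or_gt_of_ne hij with h | h
  · exact absurd (hi.1 j) (not_le.2 (hj.2 i h))
  · exact absurd (hj.1 i) (not_le.2 (hi.2 j h))

lemma Locations.iUnion_region (C : Locations F) (hC : (Set.range C.pt).Nonempty) :
    ⋃ j, C.region j = Set.univ := by
  refine Set.eq_univ_of_forall fun z => Set.mem_iUnion.2 ?_
  have : Nonempty (Fin C.N) := Set.range_nonempty_iff_nonempty.1 hC
  -- the smallest of the indices at which the distance to `z` is minimal
  let s : Finset (Fin C.N) := Finset.univ.filter fun j => ∀ l, ‖z - C.pt j‖ ≤ ‖z - C.pt l‖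
  have hs : s.Nonempty := by
    obtain ⟨j, hj⟩ := Finite.exists_min fun j => ‖z - C.pt j‖
    exact ⟨j, by simpa [s] using hj⟩
  have hmem := s.min'_mem hs
  have hmin : ∀ l, ‖z - C.pt (s.min' hs)‖ ≤ ‖z - C.pt l‖ := by simpa [s] using hmem
  refine ⟨s.min' hs, hmin, fun l hl => lt_of_not_ge fun h => ?_⟩
  have : l ∈ s := by simpa [s] using fun i => h.trans (hmin i)
  exact absurd (s.min'_le l this) (not_le.2 hl)

variable [MeasurableSpace F] [BorelSpace F]

lemma Locations.measurableSet_region (C : Locations F) (j : Fin C.N) :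
    MeasurableSet (C.region j) := by
  have h1 : ∀ l, MeasurableSet {z : F | ‖z - C.pt j‖ ≤ ‖z - C.pt l‖} := fun l =>
    (isClosed_le (by fun_prop) (by fun_prop)).measurableSet
  have h2 : ∀ l, MeasurableSet {z : F | ‖z - C.pt j‖ < ‖z - C.pt l‖} := fun l =>
    (isOpen_lt (by fun_prop) (by fun_prop)).measurableSet
  have h3 : C.region j = (⋂ l, {z : F | ‖z - C.pt j‖ ≤ ‖z - C.pt l‖}) ∩
      ⋂ l, ⋂ (_ : l < j), {z : F | ‖z - C.pt j‖ < ‖z - C.pt l‖} := by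
    ext z; simp [Locations.region]
  rw [h3]
  exact (MeasurableSet.iInter h1).inter
    (MeasurableSet.iInter fun l => MeasurableSet.iInter fun _ => h2 l)

lemma Locations.sum_measure_region (C : Locations F) (hC : (Set.range C.pt).Nonempty)
    (μ : Measure F) : ∑ j, μ (C.region j) = μ Set.univ := by
  rw [← C.iUnion_region hC, measure_iUnion C.pairwise_disjoint_region C.measurableSet_region,
    tsum_fintype]

/-- The cost of moving every point to the location of its Voronoi region is at most the mean of the
`ρ`-th power of the distance to the set of locations. -/
lemma Locations.sum_setLIntegral_region_le (C : Locations F) (μ : Measure F) (ρ : ℕ) :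
    ∑ j, ∫⁻ z in C.region j, ‖z - C.pt j‖ₑ ^ ρ ∂μ ≤
      ∫⁻ z, Metric.infEDist z (Set.range C.pt) ^ ρ ∂μ := by
  calc ∑ j, ∫⁻ z in C.region j, ‖z - C.pt j‖ₑ ^ ρ ∂μ
      ≤ ∑ j, ∫⁻ z in C.region j, Metric.infEDist z (Set.range C.pt) ^ ρ ∂μ := by
        refine Finset.sum_le_sum fun j _ =>
          setLIntegral_mono' (C.measurableSet_region j) fun z hz => ?_
        gcongr
        refine Metric.le_infEDist.2 ?_
        rintro _ ⟨l, rfl⟩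
        rw [edist_eq_enorm_sub]
        exact enorm_le_iff_norm_le.2 (hz.1 l)
    _ = ∫⁻ z in ⋃ j, C.region j, Metric.infEDist z (Set.range C.pt) ^ ρ ∂μ := by
        rw [lintegral_iUnion C.measurableSet_region C.pairwise_disjoint_region, tsum_fintype]
    _ ≤ _ := setLIntegral_le_lintegral _ _

end Voronoi

/-! ### Fine grids for Gaussian measures -/

/-- The grid of mesh `(N + 1)⁻¹` on the interval `[-(N + 1), N + 1]`. -/
def meshGrid (N : ℕ) : Finset ℝ :=
  (Finset.Icc (-(((N : ℤ) + 1) ^ 2)) (((N : ℤ) + 1) ^ 2)).image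
    fun i : ℤ => (i : ℝ) / ((N : ℝ) + 1)

lemma zero_mem_meshGrid (N : ℕ) : (0 : ℝ) ∈ meshGrid N := by
  refine Finset.mem_image.2 ⟨0, Finset.mem_Icc.2 ⟨?_, ?_⟩, by simp⟩
  · simp; positivity
  · positivity

lemma exists_mem_meshGrid_abs_sub_le {N : ℕ} {a : ℝ} (ha : |a| ≤ N + 1) :
    ∃ t ∈ meshGrid N, |a - t| ≤ 1 / ((N : ℝ) + 1) := by
  have hN : (0 : ℝ) < N + 1 := by positivity
  obtain ⟨h1, h2⟩ := abs_le.1 ha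
  refine ⟨(⌊((N : ℝ) + 1) * a⌋ : ℤ) / ((N : ℝ) + 1), Finset.mem_image.2 ⟨_, ?_, rfl⟩, ?_⟩
  · rw [Finset.mem_Icc]
    constructor
    · rw [Int.le_floor]; push_cast; nlinarith
    · have : (⌊((N : ℝ) + 1) * a⌋ : ℝ) ≤ ((N : ℝ) + 1) ^ 2 :=
        (Int.floor_le _).trans (by nlinarith)
      exact_mod_cast this
  · have e : a - (⌊((N : ℝ) + 1) * a⌋ : ℝ) / ((N : ℝ) + 1) =
        Int.fract (((N : ℝ) + 1) * a) / ((N : ℝ) + 1) := by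
      rw [Int.fract]; field_simp
    rw [e, abs_of_nonneg (div_nonneg (Int.fract_nonneg _) hN.le)]
    gcongr
    exact (Int.fract_lt_one _).le

section Grid

variable {F : Type} [NormedAddCommGroup F] [InnerProductSpace ℝ F]

/-- The grid `{m + ∑ₗ √(lam l) tₗ vₗ : tₗ ∈ G l}`. -/
def gridSet {d : ℕ} (m : F) (v : OrthonormalBasis (Fin d) ℝ F) (lam : Fin d → ℝ)
    (G : Fin d → Finset ℝ) : Set F :=
  {x | ∃ t : Fin d → ℝ, (∀ l, t l ∈ G l) ∧ x = m + ∑ l, (Real.sqrt (lam l) * t l) • v l}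

lemma gridSet_finite {d : ℕ} (m : F) (v : OrthonormalBasis (Fin d) ℝ F) (lam : Fin d → ℝ)
    (G : Fin d → Finset ℝ) : (gridSet m v lam G).Finite := by
  have h : gridSet m v lam G =
      (fun t : Fin d → ℝ => m + ∑ l, (Real.sqrt (lam l) * t l) • v l) ''
        (Fintype.piFinset G : Set (Fin d → ℝ)) := by
    ext x
    simp only [gridSet, Set.mem_ofPred_eq, Set.mem_image, Finset.mem_coe, Fintype.mem_piFinset]
    exact exists_congr fun t => and_congr_right fun _ => eq_comm
  rw [h]
  exact (Finset.finite_toSet _).image _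

lemma mem_gridSet_meshGrid {d : ℕ} (m : F) (v : OrthonormalBasis (Fin d) ℝ F) (lam : Fin d → ℝ)
    (N : ℕ) : m ∈ gridSet m v lam fun _ => meshGrid N :=
  ⟨0, fun _ => zero_mem_meshGrid N, by simp⟩

/-- The fine grids approach every point whose deviation from `m` has no component along the basis
vectors with eigenvalue `0`, the directions in which the grid does not extend. -/
lemma tendsto_infEDist_gridSet {d : ℕ} (m : F) (v : OrthonormalBasis (Fin d) ℝ F)
    (lam : Fin d → ℝ) (hlam : ∀ l, 0 ≤ lam l) (z : F)
    (hz : ∀ l, lam l = 0 → inner ℝ (v l) (z - m) = 0) :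
    Filter.Tendsto (fun N : ℕ => Metric.infEDist z (gridSet m v lam fun _ => meshGrid N))
      Filter.atTop (nhds 0) := by
  -- the standardised coordinates of `z`; the division by `0` is harmless by `hz`
  let a : Fin d → ℝ := fun l => inner ℝ (v l) (z - m) / Real.sqrt (lam l)
  have ha : ∀ l, Real.sqrt (lam l) * a l = inner ℝ (v l) (z - m) := by
    intro l
    by_cases h : lam l = 0
    · rw [hz l h]; simp [h]
    · have : Real.sqrt (lam l) ≠ 0 := (Real.sqrt_pos.2 ((hlam l).lt_of_ne' h)).ne'
      simp only [a]; field_simp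
  have hza : z - m = ∑ l, (Real.sqrt (lam l) * a l) • v l := by
    simp_rw [ha]; exact (v.sum_repr' (z - m)).symm
  have hlim : Filter.Tendsto (fun N : ℕ => ENNReal.ofReal
      ((∑ l, Real.sqrt (lam l)) * (1 / ((N : ℝ) + 1)))) Filter.atTop (nhds 0) := by
    have := (tendsto_one_div_add_atTop_nhds_zero_nat (𝕜 := ℝ)).const_mul
      (∑ l, Real.sqrt (lam l))
    simpa using ENNReal.tendsto_ofReal this
  refine tendsto_of_tendsto_of_tendsto_of_le_of_le' tendsto_const_nhds hlim
    (Filter.Eventually.of_forall fun _ => zero_le) ?_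
  filter_upwards [Filter.eventually_ge_atTop ⌈∑ l, |a l|⌉₊] with N hN
  have hN' : ∀ l, |a l| ≤ N + 1 := fun l =>
    calc |a l| ≤ ∑ l, |a l| :=
          Finset.single_le_sum (f := fun l => |a l|) (fun _ _ => abs_nonneg _) (Finset.mem_univ l)
      _ ≤ N := Nat.ceil_le.1 hN
      _ ≤ N + 1 := by simp
  choose t ht hat using fun l => exists_mem_meshGrid_abs_sub_le (hN' l)
  have hmem : m + ∑ l, (Real.sqrt (lam l) * t l) • v l ∈ gridSet m v lam fun _ => meshGrid N :=
    ⟨t, ht, rfl⟩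
  refine (Metric.infEDist_le_edist_of_mem hmem).trans ?_
  rw [edist_dist, dist_eq_norm]
  refine ENNReal.ofReal_le_ofReal ?_
  have e : z - (m + ∑ l, (Real.sqrt (lam l) * t l) • v l) =
      ∑ l, (Real.sqrt (lam l) * (a l - t l)) • v l := by
    rw [← sub_sub, hza, ← Finset.sum_sub_distrib]
    refine Finset.sum_congr rfl fun l _ => ?_
    rw [← sub_smul, mul_sub]
  rw [e, Finset.sum_mul]
  refine (norm_sum_le _ _).trans (Finset.sum_le_sum fun l _ => ?_)
  rw [norm_smul, v.norm_eq_one, mul_one, Real.norm_eq_abs, abs_mul,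
    abs_of_nonneg (Real.sqrt_nonneg _)]
  exact mul_le_mul_of_nonneg_left (hat l) (Real.sqrt_nonneg _)

variable [FiniteDimensional ℝ F] [MeasurableSpace F] [BorelSpace F]

lemma exists_orthonormalBasis_covarianceBilin (μ : Measure F) :
    ∃ (v : OrthonormalBasis (Fin (Module.finrank ℝ F)) ℝ F)
      (lam : Fin (Module.finrank ℝ F) → ℝ),
      ∀ l y, covarianceBilin μ (v l) y = lam l * inner ℝ (v l) y := by
  let T : F →L[ℝ] F := InnerProductSpace.continuousLinearMapOfBilin (covarianceBilin μ)
  have hT : ∀ x y, inner ℝ (T x) y = covarianceBilin μ x y := fun x y =>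
    InnerProductSpace.continuousLinearMapOfBilin_apply (covarianceBilin μ) x y
  have hsymm : T.toLinearMap.IsSymmetric := fun x y => by
    rw [ContinuousLinearMap.coe_coe, hT, real_inner_comm, hT, covarianceBilin_comm]
  refine ⟨hsymm.eigenvectorBasis rfl, hsymm.eigenvalues rfl, fun l y => ?_⟩
  have h := hsymm.apply_eigenvectorBasis rfl l
  rw [ContinuousLinearMap.coe_coe] at h
  rw [← hT, h, real_inner_smul_left]
  rfl

lemma IsGaussian.lintegral_edist_pow_lt_top (μ : Measure F) [IsGaussian μ] (m : F) (ρ : ℕ) :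
    ∫⁻ z, edist z m ^ ρ ∂μ < ∞ := by
  rcases eq_or_ne ρ 0 with rfl | hρ
  · simp
  have h : MemLp (fun z => z - m) ρ μ := (IsGaussian.memLp_id μ ρ (by simp)).sub (memLp_const m)
  have := lintegral_rpow_enorm_lt_top_of_eLpNorm_lt_top (by simpa using hρ) (by simp) h.2
  simpa [edist_eq_enorm_sub] using this

/-- Every Gaussian measure has grid-structured locations whose cost is as small as desired: along
the fine grids centred at the mean, the distance to the grid tends to `0` almost everywhere, and it
is dominated by the distance to the mean, which has moments of all orders. -/
lemma IsGaussian.exists_isGrid_lt (μ : Measure F) [IsGaussian μ] {ρ : ℕ} (hρ : ρ ≠ 0)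
    {δ : ℝ≥0∞} (hδ : 0 < δ) :
    ∃ C : Locations F, C.IsGrid μ ∧ ∑ j, ∫⁻ z in C.region j, ‖z - C.pt j‖ₑ ^ ρ ∂μ < δ := by
  have hL2 : MemLp id 2 μ := IsGaussian.memLp_two_id
  obtain ⟨v, lam, hv⟩ := exists_orthonormalBasis_covarianceBilin μ
  have hself : ∀ l, covarianceBilin μ (v l) (v l) = lam l := fun l => by
    rw [hv, real_inner_self_eq_norm_sq, v.norm_eq_one]; simp
  have hlam : ∀ l, 0 ≤ lam l := fun l => hself l ▸ covarianceBilin_self_nonneg _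
  set m := ∫ y, y ∂μ with hm
  -- the coordinates along eigenvectors with eigenvalue `0` are almost surely constant
  have hae : ∀ᵐ z ∂μ, ∀ l, lam l = 0 → inner ℝ (v l) (z - m) = 0 := by
    refine ae_all_iff.2 fun l => ?_
    by_cases h0 : lam l = 0
    · have hvar : Var[fun u => inner ℝ (v l) u; μ] = 0 := by
        rw [← covarianceBilin_self hL2, hself, h0]
      have hint : ∫ u, inner ℝ (v l) u ∂μ = inner ℝ (v l) m :=
        integral_inner (hL2.integrable (by simp)) (v l)
      filter_upwards [ae_eq_integral_of_variance_eq_zero (hL2.const_inner (v l)) hvar] with z hz _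
      rw [inner_sub_right, ← hint]
      exact sub_eq_zero.2 hz
    · exact Filter.Eventually.of_forall fun z h => absurd h h0
  let A : ℕ → Set F := fun N => gridSet m v lam fun _ => meshGrid N
  have hlim : Filter.Tendsto (fun N => ∫⁻ z, Metric.infEDist z (A N) ^ ρ ∂μ) Filter.atTop
      (nhds (∫⁻ _, 0 ∂μ)) := by
    refine tendsto_lintegral_of_dominated_convergence (fun z => edist z m ^ ρ)
      (fun N => measurable_infEDist.pow_const _)
      (fun N => Filter.Eventually.of_forall fun z => ?_)
      (IsGaussian.lintegral_edist_pow_lt_top μ m ρ).ne ?_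
    · dsimp only
      gcongr
      exact Metric.infEDist_le_edist_of_mem (mem_gridSet_meshGrid m v lam N)
    · filter_upwards [hae] with z hz
      have h := (tendsto_infEDist_gridSet m v lam hlam z hz)
      have := ((ENNReal.continuous_pow ρ).tendsto 0).comp h
      simpa [hρ, Function.comp_def] using this
  rw [lintegral_zero] at hlim
  obtain ⟨N, hN⟩ := (hlim.eventually_lt_const hδ).exists
  obtain ⟨C, hC⟩ := exists_locations_range_eq (gridSet_finite m v lam fun _ => meshGrid N).toFinset
  rw [Set.Finite.coe_toFinset] at hC
  refine ⟨C, ⟨v, lam, fun _ => meshGrid N, hv, fun _ => ⟨0, zero_mem_meshGrid N⟩, hC⟩, ?_⟩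
  refine (C.sum_setLIntegral_region_le μ ρ).trans_lt ?_
  rw [hC]
  exact hN

lemma Locations.IsGrid.range_nonempty {C : Locations F} {μ : Measure F} (hC : C.IsGrid μ) :
    (Set.range C.pt).Nonempty := by
  obtain ⟨v, lam, G, -, hG, h⟩ := hC
  choose t ht using hG
  rw [h]
  exact ⟨_, t, ht, rfl⟩

end Grid

/-! ### The stochastic layers -/

/-- The instance search at `α = Params n m` is expensive; this states its result at a general
type. -/
lemma sFinite_of_isProbabilityMeasure {α : Type*} [MeasurableSpace α] (μ : Measure α)
    [IsProbabilityMeasure μ] : SFinite μ :=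
  inferInstance

section Layers

variable {D n m : ℕ}

lemma continuous_affine : Continuous fun x : Params n m × Stack D n => affine x.1 x.2 := by
  unfold affine
  fun_prop

lemma measurable_affine : Measurable fun x : Params n m × Stack D n => affine x.1 x.2 :=
  continuous_affine.measurable

lemma lipschitzWith_act {σ : Vec n → Vec n} {L : ℝ≥0} (hσ : LipschitzWith L σ) :
    LipschitzWith L (act (D := D) σ) := by
  refine LipschitzWith.of_dist_le_mul fun x y => ?_
  rw [dist_eq_norm, dist_eq_norm]
  refine le_of_sq_le_sq ?_ (by positivity)
  rw [mul_pow, PiLp.norm_sq_eq_of_L2, PiLp.norm_sq_eq_of_L2, Finset.mul_sum]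
  refine Finset.sum_le_sum fun d _ => ?_
  rw [← mul_pow]
  have := hσ.dist_le_mul (x d) (y d)
  rw [dist_eq_norm, dist_eq_norm] at this
  exact pow_le_pow_left₀ (norm_nonneg _) this 2

lemma norm_affine_sub_le (w : Params n m) (x y : Stack D n) :
    ‖affine w x - affine w y‖ ≤ ‖w.1‖ * ‖x - y‖ := by
  refine le_of_sq_le_sq ?_ (by positivity)
  rw [mul_pow, PiLp.norm_sq_eq_of_L2, PiLp.norm_sq_eq_of_L2, Finset.mul_sum]
  refine Finset.sum_le_sum fun d _ => ?_
  rw [← mul_pow]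
  refine pow_le_pow_left₀ (norm_nonneg _) ?_ 2
  have : (affine w x - affine w y) d = w.1 ((x - y) d) := by
    simp [affine]
  rw [this]
  exact w.1.le_opNorm _

/-- A stochastic affine layer expands distances by at most `s` in the `ρ`-th mean. For `D = 0` this
holds because the stacked space is a point; otherwise the factor `D^(1/2)` is at least `1`. -/
lemma lintegral_enorm_affine_sub_le {p : Measure (Params n m)} {ρ : ℕ} (hρ : ρ ≠ 0) {s : ℝ≥0}
    (hs : (D : ℝ≥0∞) ^ (1 / 2 : ℝ) * (∫⁻ w, ‖w.1‖ₑ ^ ρ ∂p) ^ (1 / (ρ : ℝ)) ≤ s)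
    (x y : Stack D n) :
    ∫⁻ w, ‖affine w x - affine w y‖ₑ ^ ρ ∂p ≤ (s : ℝ≥0∞) ^ ρ * ‖x - y‖ₑ ^ ρ := by
  rcases Nat.eq_zero_or_pos D with rfl | hD
  · have : ∀ w : Params n m, affine w x - affine w y = 0 := fun w => Subsingleton.elim _ _
    simp [this, hρ]
  have hM : ∫⁻ w, ‖w.1‖ₑ ^ ρ ∂p ≤ (s : ℝ≥0∞) ^ ρ := by
    have h1 : (1 : ℝ≥0∞) ≤ (D : ℝ≥0∞) ^ (1 / 2 : ℝ) :=
      ENNReal.one_le_rpow (by exact_mod_cast hD) (by norm_num)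
    have h2 := (le_mul_of_one_le_left zero_le h1).trans hs
    have hρ' : (ρ : ℝ) ≠ 0 := by exact_mod_cast hρ
    calc ∫⁻ w, ‖w.1‖ₑ ^ ρ ∂p = ((∫⁻ w, ‖w.1‖ₑ ^ ρ ∂p) ^ (1 / (ρ : ℝ))) ^ ρ := by
          rw [← ENNReal.rpow_natCast, ← ENNReal.rpow_mul, one_div_mul_cancel hρ', ENNReal.rpow_one]
      _ ≤ _ := by gcongr
  calc ∫⁻ w, ‖affine w x - affine w y‖ₑ ^ ρ ∂p
      ≤ ∫⁻ w, ‖w.1‖ₑ ^ ρ * ‖x - y‖ₑ ^ ρ ∂p := by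
        refine lintegral_mono fun w => ?_
        rw [← mul_pow]
        gcongr
        rw [← enorm_norm w.1, ← enorm_norm (x - y), ← enorm_mul]
        refine enorm_le_iff_norm_le.2 ((norm_affine_sub_le w x y).trans (le_abs_self _))
    _ = (∫⁻ w, ‖w.1‖ₑ ^ ρ ∂p) * ‖x - y‖ₑ ^ ρ := by
        rw [lintegral_mul_const _ (by fun_prop)]
    _ ≤ _ := by gcongr

end Layers

section Network

variable {D : ℕ} {n : ℕ → ℕ} {σ : ∀ k, Vec (n k) → Vec (n k)}

lemma measurable_layer (hσ : ∀ k, Measurable (act (D := D) (σ k))) (X : Stack D (n 0)) :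
    ∀ k, Measurable fun w : ∀ k, Params (n k) (n (k + 1)) => layer σ w X k
  | 0 => measurable_const
  | 1 => by
      have h : Measurable fun w : ∀ k, Params (n k) (n (k + 1)) => (w 0, X) :=
        (measurable_pi_apply 0).prodMk measurable_const
      exact measurable_affine.comp h
  | k + 2 => by
      have h : Measurable fun w : ∀ k, Params (n k) (n (k + 1)) =>
          (w (k + 1), act (σ (k + 1)) (layer σ w X (k + 1))) :=
        (measurable_pi_apply (k + 1)).prodMk ((hσ (k + 1)).comp (measurable_layer hσ X (k + 1)))
      exact measurable_affine.comp h

lemma layer_congr (X : Stack D (n 0)) {w w' : ∀ k, Params (n k) (n (k + 1))} :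
    ∀ k, (∀ i < k, w i = w' i) → layer σ w X k = layer σ w' X k
  | 0, _ => rfl
  | 1, h => by rw [layer, layer, h 0 zero_lt_one]
  | k + 2, h => by
      rw [layer, layer, h (k + 1) (by omega), layer_congr X (k + 1) fun i hi => h i (by omega)]

variable {p : ∀ k, Measure (Params (n k) (n (k + 1)))} [∀ k, IsProbabilityMeasure (p k)]

/-- The parameters of a layer are independent of the input to this layer. -/
lemma outputLaw_succ (hσ : ∀ k, Measurable (act (D := D) (σ k))) (X : Stack D (n 0)) (k : ℕ) :
    outputLaw σ p X (k + 1) = ((p (k + 1)).prod (outputLaw σ p X k)).map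
      fun x => affine x.1 (act (σ (k + 1)) x.2) := by
  have hind : IndepFun (fun w : ∀ k, Params (n k) (n (k + 1)) => w (k + 1))
      (fun w => layer σ w X (k + 1)) (Measure.infinitePi p) := by
    have h := (iIndepFun_infinitePi (P := p) (X := fun _ => id) fun _ => measurable_id)
      |>.indepFun_finset {k + 1} (Finset.range (k + 1)) (by simp) fun i => measurable_pi_apply i
    -- the layer depends on the parameters with index at most `k` only; the others are set to `0`
    let e : (∀ i : Finset.range (k + 1), Params (n i) (n (i + 1))) →
        ∀ i, Params (n i) (n (i + 1)) := fun u i =>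
      if hi : i ∈ Finset.range (k + 1) then u ⟨i, hi⟩ else 0
    have he : Measurable e := by
      refine measurable_pi_lambda _ fun i => ?_
      by_cases hi : i ∈ Finset.range (k + 1)
      · simpa only [e, hi, dite_true] using measurable_pi_apply _
      · simpa only [e, hi, dite_false] using measurable_const
    have hl : Measurable fun u : ∀ i : ({k + 1} : Finset ℕ), Params (n i) (n (i + 1)) =>
        u ⟨k + 1, by simp⟩ := measurable_pi_apply _
    have h' := h.comp hl ((measurable_layer hσ X (k + 1)).comp he)
    convert! h' using 1
    funext w
    refine layer_congr X (k + 1) fun i hi => ?_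
    simp only [e, Finset.mem_range, hi, dite_true, id]
  have hm := measurable_layer hσ X (k + 1)
  have hp := (indepFun_iff_map_prod_eq_prod_map_map (measurable_pi_apply _).aemeasurable
    hm.aemeasurable).1 hind
  rw [Measure.infinitePi_map_eval] at hp
  rw [outputLaw, outputLaw, ← hp, Measure.map_map]
  · rfl
  · exact measurable_affine.comp (measurable_fst.prodMk ((hσ _).comp measurable_snd))
  · exact (measurable_pi_apply _).prodMk hm

end Network

/-! ### Couplings with the components of a mixture -/

section Couplings

/-- A coupling of `ν` with a mixture `∑ᵢ πᵢ μᵢ` that keeps track of the components: `γ i` is the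
part of the coupling whose second marginal is `πᵢ μᵢ`. -/
structure IsCoupling {F : Type} [MeasurableSpace F] (ν : Measure F) (q : Mixture F)
    (γ : q.ι → Measure (F × F)) : Prop where
  finite : ∀ i, IsFiniteMeasure (γ i)
  fst : ∑ i, (γ i).map Prod.fst = ν
  snd : ∀ i, (γ i).map Prod.snd = q.weight i • q.comp i

/-- The transport cost of a family of measures on `F × F`. -/
def cost {F ι : Type} [NormedAddCommGroup F] [MeasurableSpace F] [Fintype ι] (ρ : ℕ)
    (γ : ι → Measure (F × F)) : ℝ≥0∞ :=
  (∑ i, ∫⁻ z, ‖z.1 - z.2‖ₑ ^ ρ ∂(γ i)) ^ (1 / (ρ : ℝ))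

lemma IsCoupling.wasserstein_le_cost {F : Type} [NormedAddCommGroup F] [MeasurableSpace F]
    {ν : Measure F} {q : Mixture F} {γ : q.ι → Measure (F × F)} (h : IsCoupling ν q γ) (ρ : ℕ) :
    wasserstein ρ ν q.law ≤ cost ρ γ := by
  refine ENNReal.rpow_le_rpow ?_ (by positivity)
  refine (iInf₂_le (∑ i, γ i) ⟨?_, ?_⟩).trans (lintegral_finsetSum_measure _ _ _).le
  · rw [Measure.map_finset_sum measurable_fst.aemeasurable, h.fst]
  · rw [Measure.map_finset_sum measurable_snd.aemeasurable, Mixture.law]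
    simp_rw [h.snd]

/-- Minkowski's inequality for a finite family of functions on different measure spaces. -/
lemma sum_lintegral_add_pow_le {α ι : Type*} [MeasurableSpace α] [Fintype ι] {ρ : ℕ} (hρ : 1 ≤ ρ)
    (ν : ι → Measure α) {f g : ι → α → ℝ≥0∞} (hf : ∀ i, Measurable (f i))
    (hg : ∀ i, Measurable (g i)) :
    (∑ i, ∫⁻ x, (f i x + g i x) ^ ρ ∂(ν i)) ^ (1 / (ρ : ℝ)) ≤
      (∑ i, ∫⁻ x, f i x ^ ρ ∂(ν i)) ^ (1 / (ρ : ℝ)) +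
        (∑ i, ∫⁻ x, g i x ^ ρ ∂(ν i)) ^ (1 / (ρ : ℝ)) := by
  have hρ1 : (1 : ℝ) ≤ ρ := by exact_mod_cast hρ
  have hρ0 : (ρ : ℝ) ≠ 0 := by positivity
  have hroot : ∀ a : ℝ≥0∞, (a ^ (1 / (ρ : ℝ))) ^ (ρ : ℝ) = a := fun a => by
    rw [← ENNReal.rpow_mul, one_div_mul_cancel hρ0, ENNReal.rpow_one]
  simp_rw [← ENNReal.rpow_natCast]
  have h := ENNReal.Lp_add_le Finset.univ
    (fun i => (∫⁻ x, f i x ^ (ρ : ℝ) ∂(ν i)) ^ (1 / (ρ : ℝ)))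
    (fun i => (∫⁻ x, g i x ^ (ρ : ℝ) ∂(ν i)) ^ (1 / (ρ : ℝ))) hρ1
  simp_rw [hroot] at h
  refine le_trans ?_ h
  gcongr with i
  rw [← hroot (∫⁻ x, (f i x + g i x) ^ (ρ : ℝ) ∂(ν i))]
  gcongr
  exact ENNReal.lintegral_Lp_add_le (hf i).aemeasurable (hg i).aemeasurable hρ1

variable {D n m : ℕ} {σ : Vec n → Vec n} {p : Measure (Params n m)} {ν : Measure (Stack D n)}
  {q : Mixture (Stack D n)} {γ : q.ι → Measure (Stack D n × Stack D n)}

/-- The pair of outputs of the next layer, with common parameters, when the first input is `z` and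
the second one is the location `c`. -/
def layerPair (σ : Vec n → Vec n) (c : Stack D n)
    (x : Params n m × (Stack D n × Stack D n)) : Stack D m × Stack D m :=
  (affine x.1 (act σ x.2.1), affine x.1 (act σ c))

lemma measurable_layerPair (hσ : Measurable (act (D := D) σ)) (c : Stack D n) :
    Measurable (layerPair (m := m) σ c) :=
  (measurable_affine.comp (measurable_fst.prodMk (hσ.comp measurable_snd.fst))).prodMk
    (measurable_affine.comp (measurable_fst.prodMk measurable_const))

/-- The coupling at the next layer: the part of the `i`-th coupling with second component in the
region `Rᵢⱼ` is moved to the location `cᵢⱼ` in the second component, and both components are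
propagated with common parameters of the layer. -/
def nextCoupling (σ : Vec n → Vec n) (p : Measure (Params n m)) {q : Mixture (Stack D n)}
    (C : q.ι → Locations (Stack D n)) (γ : q.ι → Measure (Stack D n × Stack D n)) :
    (nextMixture σ p q C).ι → Measure (Stack D m × Stack D m) :=
  fun ij => (p.prod ((γ ij.1).restrict (Prod.snd ⁻¹' (C ij.1).region ij.2))).map
    (layerPair σ ((C ij.1).pt ij.2))

lemma nextCoupling_apply (C : q.ι → Locations (Stack D n)) (i : q.ι) (j : Fin (C i).N) :
    nextCoupling σ p C γ ⟨i, j⟩ =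
      (p.prod ((γ i).restrict (Prod.snd ⁻¹' (C i).region j))).map (layerPair σ ((C i).pt j)) :=
  rfl

lemma sum_nextMixture {M : Type*} [AddCommMonoid M] (C : q.ι → Locations (Stack D n))
    (f : (nextMixture σ p q C).ι → M) : ∑ ij, f ij = ∑ i, ∑ j, f ⟨i, j⟩ :=
  Fintype.sum_sigma f

lemma sum_setLIntegral_snd_region {C : Locations (Stack D n)} (hC : (Set.range C.pt).Nonempty)
    (μ : Measure (Stack D n × Stack D n)) (f : Stack D n × Stack D n → ℝ≥0∞) :
    ∑ j, ∫⁻ z in Prod.snd ⁻¹' C.region j, f z ∂μ = ∫⁻ z, f z ∂μ := by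
  rw [← tsum_fintype (L := .unconditional _), ← lintegral_iUnion, ← Set.preimage_iUnion,
    C.iUnion_region hC]
  · simp
  · exact fun j => measurable_snd (C.measurableSet_region j)
  · exact fun i j hij => (C.pairwise_disjoint_region hij).preimage _

lemma IsCoupling.next [IsProbabilityMeasure p] (hγ : IsCoupling ν q γ)
    (hσ : Measurable (act (D := D) σ)) {C : q.ι → Locations (Stack D n)}
    (hC : ∀ i, (Set.range (C i).pt).Nonempty) :
    IsCoupling ((p.prod ν).map fun x => affine x.1 (act σ x.2)) (nextMixture σ p q C)
      (nextCoupling σ p C γ) := by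
  have : SFinite p := sFinite_of_isProbabilityMeasure p
  have := hγ.finite
  have : IsFiniteMeasure ν := by
    rw [← hγ.fst]; infer_instance
  have hA : Measurable fun x : Params n m × Stack D n => affine x.1 (act σ x.2) :=
    measurable_affine.comp (measurable_fst.prodMk (hσ.comp measurable_snd))
  refine ⟨fun ij => ?_, ?_, fun ij => ?_⟩
  · unfold nextCoupling; infer_instance
  · refine Measure.ext_of_lintegral _ fun f hf => ?_
    have hg : Measurable fun z => ∫⁻ w, f (affine w (act σ z)) ∂p :=
      (hf.comp hA).lintegral_prod_left'
    have h1 : ∀ i j, ∫⁻ y, f y ∂((nextCoupling σ p C γ ⟨i, j⟩).map Prod.fst) =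
        ∫⁻ z in Prod.snd ⁻¹' (C i).region j, ∫⁻ w, f (affine w (act σ z.1)) ∂p ∂(γ i) := by
      intro i j
      have hl := measurable_layerPair (m := m) hσ ((C i).pt j)
      rw [nextCoupling_apply, Measure.map_map measurable_fst hl,
        lintegral_map hf (measurable_fst.comp hl),
        lintegral_prod_symm'
          (fun x => f ((Prod.fst ∘ layerPair σ ((C i).pt j)) x)) (hf.comp (measurable_fst.comp hl))]
      rfl
    rw [lintegral_finsetSum_measure, sum_nextMixture]
    simp_rw [h1, sum_setLIntegral_snd_region (hC _)]
    rw [lintegral_map hf hA,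
      lintegral_prod_symm' (fun x : Params n m × Stack D n => f (affine x.1 (act σ x.2)))
        (hf.comp hA), ← hγ.fst,
      lintegral_finsetSum_measure]
    exact Finset.sum_congr rfl fun i _ => (lintegral_map hg measurable_fst).symm
  · obtain ⟨i, j⟩ := ij
    have hc : Measurable fun w : Params n m => affine w (act σ ((C i).pt j)) :=
      measurable_affine.comp (measurable_id.prodMk measurable_const)
    have hw : γ i (Prod.snd ⁻¹' (C i).region j) = q.weight i * q.comp i ((C i).region j) := by
      rw [← Measure.map_apply measurable_snd ((C i).measurableSet_region j), hγ.snd]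
      simp
    rw [nextCoupling_apply, Measure.map_map measurable_snd (measurable_layerPair hσ _)]
    change (p.prod _).map ((fun w => affine w (act σ ((C i).pt j))) ∘ Prod.fst) = _
    rw [← Measure.map_map hc measurable_fst, Measure.map_fst_prod, Measure.restrict_apply_univ,
      hw, Measure.map_smul]
    rfl

/-- The error recursion: moving from `z` to the location `c` of the region of `y` costs at most
`L ‖z - y‖ + ℓ(R) ‖y - c‖` after the activation, and the stochastic layer multiplies this by `s` in
the `ρ`-th mean. -/
lemma IsCoupling.cost_next_le [IsProbabilityMeasure p] (hγ : IsCoupling ν q γ) {ρ : ℕ} (hρ : 1 ≤ ρ)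
    {L : ℝ≥0} (hσ : LipschitzWith L (act (D := D) σ)) (C : q.ι → Locations (Stack D n))
    {ℓ : Set (Stack D n) → ℝ≥0} (hℓ : ∀ R, LipschitzOnWith (ℓ R) (act (D := D) σ) R) {s : ℝ≥0}
    (hs : ∀ x y : Stack D n,
      ∫⁻ w, ‖affine w x - affine w y‖ₑ ^ ρ ∂p ≤ (s : ℝ≥0∞) ^ ρ * ‖x - y‖ₑ ^ ρ)
    (hC : ∀ i, (Set.range (C i).pt).Nonempty) :
    cost ρ (nextCoupling σ p C γ) ≤ s * (L * cost ρ γ + signatureBound ρ ℓ q C) := by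
  have : SFinite p := sFinite_of_isProbabilityMeasure p
  have := hγ.finite
  have hρ0 : (ρ : ℝ) ≠ 0 := by positivity
  have hroot : ∀ a b : ℝ≥0∞, (a ^ ρ * b) ^ (1 / (ρ : ℝ)) = a * b ^ (1 / (ρ : ℝ)) := fun a b => by
    rw [ENNReal.mul_rpow_of_nonneg _ _ (by positivity), ← ENNReal.rpow_natCast, ← ENNReal.rpow_mul,
      mul_one_div_cancel hρ0, ENNReal.rpow_one]
  let f : (nextMixture σ p q C).ι → Stack D n × Stack D n → ℝ≥0∞ := fun _ z =>
    L * ‖z.1 - z.2‖ₑ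
  let g : (nextMixture σ p q C).ι → Stack D n × Stack D n → ℝ≥0∞ := fun ij z =>
    ℓ ((C ij.1).region ij.2) * ‖z.2 - (C ij.1).pt ij.2‖ₑ
  let κ : (nextMixture σ p q C).ι → Measure (Stack D n × Stack D n) := fun ij =>
    (γ ij.1).restrict (Prod.snd ⁻¹' (C ij.1).region ij.2)
  have hstep : ∀ ij, ∫⁻ z, ‖z.1 - z.2‖ₑ ^ ρ ∂(nextCoupling σ p C γ ij) ≤
      (s : ℝ≥0∞) ^ ρ * ∫⁻ z, (f ij z + g ij z) ^ ρ ∂(κ ij) := by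
    rintro ⟨i, j⟩
    have hl := measurable_layerPair (m := m) hσ.continuous.measurable ((C i).pt j)
    have hd : Measurable fun z : Stack D m × Stack D m => ‖z.1 - z.2‖ₑ ^ ρ := by fun_prop
    rw [nextCoupling_apply, lintegral_map hd hl,
      lintegral_prod_symm' (fun x => ‖(layerPair (m := m) σ ((C i).pt j) x).1 -
        (layerPair σ ((C i).pt j) x).2‖ₑ ^ ρ) (hd.comp hl),
      ← lintegral_const_mul _ (by fun_prop)]
    refine setLIntegral_mono' (measurable_snd ((C i).measurableSet_region j)) fun z hz => ?_
    refine (hs (act σ z.1) (act σ ((C i).pt j))).trans ?_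
    gcongr
    have h1 := hσ.edist_le_mul z.1 z.2
    have h2 := hℓ _ hz ((C i).pt_mem_region j)
    have h3 := edist_triangle (act σ z.1) (act σ z.2) (act σ ((C i).pt j))
    simp only [edist_eq_enorm_sub] at h1 h2 h3
    exact h3.trans (add_le_add h1 h2)
  have hf : ∑ ij, ∫⁻ z, f ij z ^ ρ ∂(κ ij) =
      (L : ℝ≥0∞) ^ ρ * ∑ i, ∫⁻ z, ‖z.1 - z.2‖ₑ ^ ρ ∂(γ i) := by
    rw [sum_nextMixture, Finset.mul_sum]
    refine Finset.sum_congr rfl fun i _ => ?_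
    rw [← lintegral_const_mul _ (by fun_prop), ← sum_setLIntegral_snd_region (hC i)]
    simp only [f, κ, mul_pow]
  have hg : ∑ ij, ∫⁻ z, g ij z ^ ρ ∂(κ ij) =
      ∑ i, q.weight i * ∑ j : Fin (C i).N, (ℓ ((C i).region j) : ℝ≥0∞) ^ ρ *
        ∫⁻ z in (C i).region j, ‖z - (C i).pt j‖ₑ ^ ρ ∂(q.comp i) := by
    rw [sum_nextMixture]
    refine Finset.sum_congr rfl fun i _ => ?_
    rw [Finset.mul_sum]
    refine Finset.sum_congr rfl fun j _ => ?_
    have hd : Measurable fun y : Stack D n => ‖y - (C i).pt j‖ₑ ^ ρ := by fun_prop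
    have hmap := setLIntegral_map (μ := γ i) ((C i).measurableSet_region j) hd measurable_snd
    rw [hγ.snd, Measure.restrict_smul, lintegral_smul_measure, smul_eq_mul] at hmap
    simp only [g, κ, mul_pow]
    rw [lintegral_const_mul _ (by fun_prop), ← hmap]
    ring
  calc cost ρ (nextCoupling σ p C γ)
      ≤ (∑ ij, (s : ℝ≥0∞) ^ ρ * ∫⁻ z, (f ij z + g ij z) ^ ρ ∂(κ ij)) ^ (1 / (ρ : ℝ)) :=
        ENNReal.rpow_le_rpow (Finset.sum_le_sum fun ij _ => hstep ij) (by positivity)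
    _ = s * (∑ ij, ∫⁻ z, (f ij z + g ij z) ^ ρ ∂(κ ij)) ^ (1 / (ρ : ℝ)) := by
        rw [← Finset.mul_sum, hroot]
    _ ≤ s * ((∑ ij, ∫⁻ z, f ij z ^ ρ ∂(κ ij)) ^ (1 / (ρ : ℝ)) +
          (∑ ij, ∫⁻ z, g ij z ^ ρ ∂(κ ij)) ^ (1 / (ρ : ℝ))) := by
        gcongr
        exact sum_lintegral_add_pow_le hρ κ (fun ij => by fun_prop) fun ij => by fun_prop
    _ = s * (L * cost ρ γ + signatureBound ρ ℓ q C) := by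
        rw [hf, hg, hroot, cost, signatureBound]

end Couplings

/-! ### Fine approximations -/

section Mixtures

lemma signatureBound_le {F : Type} [NormedAddCommGroup F] [MeasurableSpace F] {ρ : ℕ} (hρ : ρ ≠ 0)
    {ℓ : Set F → ℝ≥0} {L : ℝ≥0} (hℓ : ∀ R, ℓ R ≤ L) {q : Mixture F}
    (hq : ∑ i, q.weight i = 1) {C : q.ι → Locations F} {δ : ℝ≥0∞}
    (hC : ∀ i, ∑ j, ∫⁻ z in (C i).region j, ‖z - (C i).pt j‖ₑ ^ ρ ∂(q.comp i) ≤ δ ^ ρ) :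
    signatureBound ρ ℓ q C ≤ L * δ := by
  have hρ' : (ρ : ℝ) ≠ 0 := by exact_mod_cast hρ
  calc signatureBound ρ ℓ q C ≤ (∑ i, q.weight i * (L * δ) ^ ρ) ^ (1 / (ρ : ℝ)) := by
        refine ENNReal.rpow_le_rpow (Finset.sum_le_sum fun i _ => ?_) (by positivity)
        gcongr
        rw [mul_pow]
        refine le_trans ?_ (mul_le_mul_right (hC i) ((L : ℝ≥0∞) ^ ρ))
        rw [Finset.mul_sum]
        gcongr
        exact_mod_cast hℓ _
    _ = L * δ := by
        rw [← Finset.sum_mul, hq, one_mul, ← ENNReal.rpow_natCast, ← ENNReal.rpow_mul,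
          mul_one_div_cancel hρ', ENNReal.rpow_one]

lemma errorBound_ne_top (S : ℕ → ℝ≥0) (L : ℝ≥0) : ∀ k, errorBound S L (fun _ => 1) k ≠ ∞
  | 0 => by simp [errorBound]
  | 1 => by simp [errorBound]
  | k + 2 => by
      rw [errorBound]
      have := errorBound_ne_top S L (k + 1)
      finiteness

lemma errorBound_le_mul (S : ℕ → ℝ≥0) (L : ℝ≥0) {Δ : ℕ → ℝ≥0∞} {η : ℝ≥0∞}
    (hΔ : ∀ k, Δ (k + 1) ≤ η) : ∀ k, errorBound S L Δ k ≤ errorBound S L (fun _ => 1) k * η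
  | 0 => by simp [errorBound]
  | 1 => by simp [errorBound]
  | k + 2 => by
      rw [errorBound, errorBound]
      calc (S (k + 1) : ℝ≥0∞) * (L * errorBound S L Δ (k + 1) + Δ (k + 1))
          ≤ S (k + 1) * (L * (errorBound S L (fun _ => 1) (k + 1) * η) + η) := by
            gcongr
            · exact errorBound_le_mul S L hΔ (k + 1)
            · exact hΔ k
        _ = _ := by ring

variable {D : ℕ} {n : ℕ → ℕ}

/-- The approximating mixtures when a measure `μ` at layer `k` is discretised at the locations
`loc k μ`. The mixture at layer `0` plays no role. -/
def mixtures (σ : ∀ k, Vec (n k) → Vec (n k)) (p : ∀ k, Measure (Params (n k) (n (k + 1))))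
    (X : Stack D (n 0)) (loc : ∀ k, Measure (Stack D (n k)) → Locations (Stack D (n k))) :
    ∀ k, Mixture (Stack D (n k))
  | 0 => ⟨Empty, inferInstance, fun _ => 0, fun _ => 0⟩
  | 1 => firstMixture (p 0) X
  | k + 2 => nextMixture (σ (k + 1)) (p (k + 1)) (mixtures σ p X loc (k + 1)) fun i =>
      loc (k + 1) ((mixtures σ p X loc (k + 1)).comp i)

variable {σ : ∀ k, Vec (n k) → Vec (n k)} {p : ∀ k, Measure (Params (n k) (n (k + 1)))}
  {X : Stack D (n 0)} {loc : ∀ k, Measure (Stack D (n k)) → Locations (Stack D (n k))}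

lemma isGMM_mixtures (hp : ∀ k (z : Stack D (n k)), IsGaussian (affineLaw (p k) z))
    (hloc : ∀ k μ, IsGaussian μ → (Set.range (loc k μ).pt).Nonempty) :
    ∀ k, (mixtures σ p X loc (k + 1)).IsGMM
  | 0 => ⟨by change ∑ _ : Unit, (1 : ℝ≥0∞) = 1; simp, fun _ => hp 0 X⟩
  | k + 1 => by
      have ih := isGMM_mixtures hp hloc k
      refine ⟨?_, fun ij => hp (k + 1) _⟩
      rw [mixtures, sum_nextMixture]
      rw [← ih.weight_sum]
      refine Finset.sum_congr rfl fun i _ => ?_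
      have := ih.gaussian i
      simp only [nextMixture]
      rw [← Finset.mul_sum, Locations.sum_measure_region _ (hloc _ _ this), measure_univ, mul_one]

variable [∀ k, IsProbabilityMeasure (p k)]

/-- The law of every layer of the network has a coupling with the approximating mixture whose cost
is at most the error bound. -/
lemma exists_isCoupling_mixtures {ρ : ℕ} (hρ : 1 ≤ ρ) {L : ℝ≥0} (hσ : ∀ k, LipschitzWith L (σ k))
    (hp : ∀ k (z : Stack D (n k)), IsGaussian (affineLaw (p k) z)) {S : ℕ → ℝ≥0}
    (hS : ∀ k, (D : ℝ≥0∞) ^ (1 / 2 : ℝ) * (∫⁻ w, ‖w.1‖ₑ ^ ρ ∂(p k)) ^ (1 / (ρ : ℝ)) ≤ S k)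
    {ℓ : ∀ k, Set (Stack D (n k)) → ℝ≥0}
    (hℓ : ∀ k R, LipschitzOnWith (ℓ k R) (act (D := D) (σ k)) R)
    (hloc : ∀ k μ, IsGaussian μ → (Set.range (loc k μ).pt).Nonempty) :
    ∀ k, ∃ γ, IsCoupling (outputLaw σ p X k) (mixtures σ p X loc (k + 1)) γ ∧
      cost ρ γ ≤ errorBound S L (fun k => signatureBound ρ (ℓ k) (mixtures σ p X loc k)
        fun i => loc k ((mixtures σ p X loc k).comp i)) (k + 1)
  | 0 => by
      have hX : Measurable fun w : Params (n 0) (n 1) => affine w X :=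
        measurable_affine.comp (measurable_id.prodMk measurable_const)
      have hlaw : outputLaw σ p X 0 = affineLaw (p 0) X := by
        rw [affineLaw, ← Measure.infinitePi_map_eval p 0,
          Measure.map_map hX (measurable_pi_apply 0)]
        rfl
      have hdiag : Measurable fun z : Stack D (n 1) => (z, z) := measurable_id.prodMk measurable_id
      have := hp 0 X
      refine ⟨fun _ => (affineLaw (p 0) X).map fun z => (z, z),
        ⟨fun _ => inferInstance, ?_, fun _ => ?_⟩, ?_⟩
      · rw [hlaw, Measure.map_map measurable_fst hdiag]
        change ∑ _ : Unit, (affineLaw (p 0) X).map id = _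
        simp
      · rw [Measure.map_map measurable_snd hdiag]
        change (affineLaw (p 0) X).map id = (1 : ℝ≥0∞) • affineLaw (p 0) X
        simp
      · have h0 : ∫⁻ z : Stack D (n 1) × Stack D (n 1), ‖z.1 - z.2‖ₑ ^ ρ
            ∂((affineLaw (p 0) X).map fun z => (z, z)) = 0 := by
          rw [lintegral_map (by fun_prop) hdiag]
          simp [Nat.one_le_iff_ne_zero.1 hρ]
        have hρ' : (0 : ℝ) < 1 / (ρ : ℝ) := by positivity
        rw [cost, Finset.sum_congr rfl fun i _ => h0, Finset.sum_const_zero,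
          ENNReal.zero_rpow_of_pos hρ']
        exact zero_le
  | k + 1 => by
      obtain ⟨γ, hγ, hcost⟩ := exists_isCoupling_mixtures hρ hσ hp hS hℓ hloc k
      have hact := fun k => lipschitzWith_act (D := D) (hσ k)
      have hC : ∀ i, (Set.range
          (loc (k + 1) ((mixtures σ p X loc (k + 1)).comp i)).pt).Nonempty := fun i =>
        hloc _ _ ((isGMM_mixtures hp hloc k).gaussian i)
      refine ⟨nextCoupling (σ (k + 1)) (p (k + 1)) _ γ, ?_, ?_⟩
      · rw [outputLaw_succ (fun k => (hact k).continuous.measurable)]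
        exact hγ.next (hact (k + 1)).continuous.measurable hC
      · refine (hγ.cost_next_le hρ (hact (k + 1)) _ (hℓ (k + 1))
          (lintegral_enorm_affine_sub_le (by omega) (hS (k + 1))) hC).trans ?_
        rw [errorBound]
        gcongr

end Mixtures

end SNN

end

/-! ### Existence of accurate Gaussian mixture approximations -/

theorem mainTheorem3
    -- the order of the Wasserstein distance
    (ρ : ℕ) (hρ : ρ = 1 ∨ ρ = 2)
    -- `K` hidden layers, `n k` the width of layer `k`, and `D` input points
    (K : ℕ) (n : ℕ → ℕ) (D : ℕ) (X : SNN.Stack D (n 0))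
    -- Lipschitz activations
    (σ : ∀ k, SNN.Vec (n k) → SNN.Vec (n k)) (L : ℝ≥0) (hσ : ∀ k, LipschitzWith L (σ k))
    -- laws of the parameters of the layers, with Gaussian outputs at fixed inputs
    (p : ∀ k, Measure (SNN.Params (n k) (n (k + 1)))) [∀ k, IsProbabilityMeasure (p k)]
    (hp : ∀ k (z : SNN.Stack D (n k)), IsGaussian (SNN.affineLaw (p k) z))
    -- bounds on the weight matrices
    (S : ℕ → ℝ≥0)
    (hS : ∀ k, (D : ℝ≥0∞) ^ (1 / 2 : ℝ) * (∫⁻ w, ‖w.1‖ₑ ^ ρ ∂(p k)) ^ (1 / (ρ : ℝ)) ≤ S k)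
    -- local Lipschitz constants of the activations, no larger than the global one
    (ℓ : ∀ k, Set (SNN.Stack D (n k)) → ℝ≥0) (hℓL : ∀ k R, ℓ k R ≤ L)
    (hℓ : ∀ k R, LipschitzOnWith (ℓ k R) (SNN.act (D := D) (σ k)) R)
    (ε : ℝ) (hε : 0 < ε) :
    ∃ (q : ∀ k, SNN.Mixture (SNN.Stack D (n k)))
      (C : ∀ k, (q k).ι → SNN.Locations (SNN.Stack D (n k))),
      -- the `q k` are built from the locations `C k` by the approximation procedure
      q 1 = SNN.firstMixture (p 0) X ∧
      (∀ k, 1 ≤ k → k ≤ K → q (k + 1) = SNN.nextMixture (σ k) (p k) (q k) (C k)) ∧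
      -- the locations of every component form a finite grid
      (∀ k, 1 ≤ k → k ≤ K → ∀ i, (C k i).IsGrid ((q k).comp i)) ∧
      -- the approximations are Gaussian mixtures
      (∀ k, 1 ≤ k → k ≤ K + 1 → (q k).IsGMM) ∧
      -- the computed bound is a bound, and it is below `ε`
      SNN.wasserstein ρ (SNN.outputLaw σ p X K) (q (K + 1)).law ≤
        SNN.errorBound S L (fun k => SNN.signatureBound ρ (ℓ k) (q k) (C k)) (K + 1) ∧
      SNN.errorBound S L (fun k => SNN.signatureBound ρ (ℓ k) (q k) (C k)) (K + 1) <
        ENNReal.ofReal ε := by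
  have hρ1 : 1 ≤ ρ := by omega
  -- the error bound is a finite multiple of the largest error of a signature step
  obtain ⟨δ, hδ, hδε⟩ := ENNReal.exists_nnreal_pos_mul_lt
    (ENNReal.mul_ne_top (SNN.errorBound_ne_top S L (K + 1)) (ENNReal.coe_ne_top (r := L)))
    (ENNReal.ofReal_pos.2 hε).ne'
  have hex : ∀ k (μ : Measure (SNN.Stack D (n k))), ∃ C : SNN.Locations (SNN.Stack D (n k)),
      IsGaussian μ → C.IsGrid μ ∧
        ∑ j, ∫⁻ z in C.region j, ‖z - C.pt j‖ₑ ^ ρ ∂μ < (δ : ℝ≥0∞) ^ ρ := by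
    intro k μ
    by_cases hμ : IsGaussian μ
    · obtain ⟨C, hC⟩ := SNN.IsGaussian.exists_isGrid_lt μ (ρ := ρ) (by omega)
        (δ := (δ : ℝ≥0∞) ^ ρ) (ENNReal.pow_pos (by exact_mod_cast hδ) ρ)
      exact ⟨C, fun _ => hC⟩
    -- a measure that is not Gaussian never occurs as a component; any locations will do
    · exact ⟨⟨0, Fin.elim0, fun i => i.elim0⟩, fun h => absurd h hμ⟩
  choose loc hloc using hex
  have hne : ∀ k μ, IsGaussian μ → (Set.range (loc k μ).pt).Nonempty := fun k μ hμ =>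
    (hloc k μ hμ).1.range_nonempty
  have hgmm := SNN.isGMM_mixtures (σ := σ) (X := X) hp hne
  refine ⟨SNN.mixtures σ p X loc, fun k i => loc k ((SNN.mixtures σ p X loc k).comp i), rfl,
    fun k hk _ => ?_, fun k hk _ i => ?_, fun k hk _ => ?_, ?_, ?_⟩
  · obtain ⟨k, rfl⟩ := Nat.exists_eq_add_of_le' hk
    rfl
  · obtain ⟨k, rfl⟩ := Nat.exists_eq_add_of_le' hk
    exact (hloc _ _ ((hgmm k).gaussian i)).1
  · obtain ⟨k, rfl⟩ := Nat.exists_eq_add_of_le' hk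
    exact hgmm k
  · obtain ⟨γ, hγ, hcost⟩ := SNN.exists_isCoupling_mixtures (X := X) hρ1 hσ hp hS hℓ hne K
    exact (hγ.wasserstein_le_cost ρ).trans hcost
  · refine (SNN.errorBound_le_mul S L (η := L * δ) (fun k => ?_) (K + 1)).trans_lt ?_
    · exact SNN.signatureBound_le (by omega) (hℓL (k + 1)) (hgmm k).weight_sum fun i =>
        (hloc _ _ ((hgmm k).gaussian i)).2.le
    · rwa [← mul_assoc, mul_comm]
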